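/- Let $\Lambda$ be the set of strictly increasing continuous functions from $[0,1]$ onto $[0,1]$, let $e$ be the identity on $[0,1]$, and for $\lambda\in\Lambda$ put $\|\lambda-e\|=\sup_{t\in[0,1]}|\lambda(t)-t|$ and $\|\lambda\|^0=\sup_{0\le s<s'\le 1}\left|\log\frac{\lambda(s')-\lambda(s)}{s'-s}\right|\in[0,\infty]$. Let $\mathbb{D}$ be the space of functions $x:[0,1]\to\mathbb{R}$ which are right-continuous and have left limits, with the distance $d^0_{J_1}(x,y)=\inf_{\lambda\in\Lambda}\max\{\|\lambda\|^0,\ \sup_{s\in[0,1]}|x(s)-y(\lambda(s))|\}$, and let $\mathcal{D}$ be its Borel $\sigma$-field. Let $\mathbb{D}([0,1];\mathbb{D})$ be the space of functions $x:[0,1]\to\mathbb{D}$ which are right-continuous and have left limits with respect to $d^0_{J_1}$, with the distance $d_{\mathbb{D}}(x,y)=\inf_{\lambda\in\Lambda}\max\{\|\lambda-e\|,\ \sup_{t\in[0,1]}d^0_{J_1}(x(t),y(\lambda(t)))\}$, and let $\mathcal{D}_{\mathbb{D}}$ be its Borel $\sigma$-field. For $T\subset[0,1]$, let $\mathcal{D}^{\mathbb{D}}_{f,T}$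 be the class of all sets $\{x\in\mathbb{D}([0,1];\mathbb{D}) : (x(t_1),\ldots,x(t_k))\in H\}$ with $k\ge 1$, $t_1<\cdots<t_k$ in $T$, and $H$ in the product $\sigma$-field $\mathcal{D}^k$ on $\mathbb{D}^k$. **Theorem.** Let $T\subset[0,1]$ be dense in $[0,1]$ with $1\in T$. Then: (a) $\mathcal{D}_{\mathbb{D}}$ is the $\sigma$-field generated by $\mathcal{D}^{\mathbb{D}}_{f,T}$; (b) $\mathcal{D}^{\mathbb{D}}_{f,T}$ is a separating class of $\mathcal{D}_{\mathbb{D}}$: if $P$ and $Q$ are probability measures on $(\mathbb{D}([0,1];\mathbb{D}),\mathcal{D}_{\mathbb{D}})$ such that $P(A)=Q(A)$ for every $A\in\mathcal{D}^{\mathbb{D}}_{f,T}$, then $P=Q$. -/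

import Mathlib

open Set Filter Topology MeasureTheory
open scoped ENNReal unitInterval

/-- The space `D([0,1]; E)` of functions `[0,1] → E` which are right-continuous and have left
limits with respect to the topology of `E`. -/
structure Cadlag (E : Type*) [TopologicalSpace E] where
  toFun : I → E
  right_continuous : ∀ t : I, t < 1 → ContinuousWithinAt toFun (Ici t) t
  left_limits : ∀ t : I, 0 < t → ∃ l : E, Tendsto toFun (𝓝[<] t) (𝓝 l)

instance Cadlag.instCoeFun {E : Type*} [TopologicalSpace E] :
    CoeFun (Cadlag E) (fun _ => I → E) := ⟨Cadlag.toFun⟩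

/-- The set `Λ` of strictly increasing continuous functions from `[0,1]` onto `[0,1]`, given as the
group of order automorphisms of `[0,1]`; see `exists_timeChange_iff`. -/
abbrev TimeChange : Type := I ≃o I

theorem exists_timeChange_iff (f : I → I) :
    (∃ l : TimeChange, ⇑l = f) ↔ StrictMono f ∧ Continuous f ∧ Function.Surjective f := by
  constructor
  · rintro ⟨l, rfl⟩
    exact ⟨l.strictMono, l.continuous, l.surjective⟩
  · rintro ⟨h1, _, h3⟩
    exact ⟨h1.orderIsoOfSurjective f h3, h1.coe_orderIsoOfSurjective f h3⟩

namespace TimeChange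

/-- `‖λ - e‖ = sup_t |λ(t) - t|`. -/
noncomputable def supNorm (l : TimeChange) : ℝ≥0∞ := ⨆ t : I, edist (l t) t

/-- `‖λ‖⁰ = sup_{s < s'} |log ((λ(s') - λ(s)) / (s' - s))|`, possibly infinite. -/
noncomputable def logNorm (l : TimeChange) : ℝ≥0∞ :=
  ⨆ (s : I) (s' : I) (_ : s < s'),
    ENNReal.ofReal |Real.log (((l s' : ℝ) - (l s : ℝ)) / ((s' : ℝ) - (s : ℝ)))|

theorem supNorm_refl : supNorm (OrderIso.refl I) = 0 := by simp [supNorm]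

theorem supNorm_symm_le (l : TimeChange) : supNorm l.symm ≤ supNorm l := by
  refine iSup_le fun t => ?_
  have h := le_iSup (fun t : I => edist (l t) t) (l.symm t)
  simp only [OrderIso.apply_symm_apply] at h
  rw [edist_comm]
  exact h

theorem supNorm_trans_le (l m : TimeChange) : supNorm (l.trans m) ≤ supNorm l + supNorm m := by
  refine iSup_le fun t => ?_
  calc edist ((l.trans m) t) t ≤ edist (m (l t)) (l t) + edist (l t) t := edist_triangle _ _ _
    _ ≤ supNorm m + supNorm l :=
        add_le_add (le_iSup (fun t : I => edist (m t) t) (l t))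
          (le_iSup (fun t : I => edist (l t) t) t)
    _ = supNorm l + supNorm m := add_comm _ _

theorem le_logNorm (l : TimeChange) {s s' : I} (h : s < s') :
    ENNReal.ofReal |Real.log (((l s' : ℝ) - (l s : ℝ)) / ((s' : ℝ) - (s : ℝ)))| ≤ logNorm l :=
  le_iSup_of_le s (le_iSup_of_le s' (le_iSup_of_le h le_rfl))

theorem logNorm_refl : logNorm (OrderIso.refl I) = 0 := by
  simp only [logNorm, OrderIso.refl_apply, ENNReal.iSup_eq_zero]
  intro s s' h
  have h' : (s' : ℝ) - (s : ℝ) ≠ 0 := (sub_pos.2 (Subtype.coe_lt_coe.2 h)).ne'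
  simp [div_self h']

theorem logNorm_symm_le (l : TimeChange) : logNorm l.symm ≤ logNorm l := by
  refine iSup_le fun s => iSup_le fun s' => iSup_le fun h => ?_
  have h1 := le_logNorm l (l.symm.strictMono h)
  simp only [OrderIso.apply_symm_apply] at h1
  rw [← inv_div, Real.log_inv, abs_neg]
  exact h1

theorem logNorm_trans_le (l m : TimeChange) : logNorm (l.trans m) ≤ logNorm l + logNorm m := by
  refine iSup_le fun s => iSup_le fun s' => iSup_le fun h => ?_
  have hl := l.strictMono h
  have hm := m.strictMono hl
  have p1 : (0 : ℝ) < (s' : ℝ) - s := sub_pos.2 (Subtype.coe_lt_coe.2 h)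
  have p2 : (0 : ℝ) < (l s' : ℝ) - l s := sub_pos.2 (Subtype.coe_lt_coe.2 hl)
  have p3 : (0 : ℝ) < (m (l s') : ℝ) - m (l s) := sub_pos.2 (Subtype.coe_lt_coe.2 hm)
  have e : ((m (l s') : ℝ) - m (l s)) / ((s' : ℝ) - s)
      = (((l s' : ℝ) - l s) / ((s' : ℝ) - s))
        * (((m (l s') : ℝ) - m (l s)) / ((l s' : ℝ) - l s)) := by
    field_simp
  simp only [OrderIso.trans_apply]
  rw [e, Real.log_mul (div_pos p2 p1).ne' (div_pos p3 p2).ne']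
  refine (ENNReal.ofReal_le_ofReal (abs_add_le _ _)).trans ?_
  rw [ENNReal.ofReal_add (abs_nonneg _) (abs_nonneg _)]
  exact add_le_add (le_logNorm l h) (le_logNorm m hl)

end TimeChange

/-- `inf_{λ ∈ Λ} max (N λ) (sup_t d_E (x(t), y(λ(t))))`, for a cost `N` of a time change and the
distance `d_E` of `E`. -/
noncomputable def skorohodEDist {E : Type*} [PseudoEMetricSpace E] (N : TimeChange → ℝ≥0∞)
    (x y : Cadlag E) : ℝ≥0∞ :=
  ⨅ l : TimeChange, max (N l) (⨆ t : I, edist (x t) (y (l t)))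

theorem skorohodEDist_self {E : Type*} [PseudoEMetricSpace E] (N : TimeChange → ℝ≥0∞)
    (h0 : N (OrderIso.refl I) = 0) (x : Cadlag E) : skorohodEDist N x x = 0 := by
  refine le_antisymm (iInf_le_of_le (OrderIso.refl I) ?_) zero_le
  simp [h0]

theorem skorohodEDist_comm_le {E : Type*} [PseudoEMetricSpace E] (N : TimeChange → ℝ≥0∞)
    (hs : ∀ l : TimeChange, N l.symm ≤ N l) (x y : Cadlag E) :
    skorohodEDist N x y ≤ skorohodEDist N y x := by
  refine le_iInf fun l => iInf_le_of_le l.symm (max_le_max (hs l) (iSup_le fun t => ?_))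
  have h := le_iSup (fun t : I => edist (y t) (x (l t))) (l.symm t)
  simp only [OrderIso.apply_symm_apply] at h
  rw [edist_comm]
  exact h

theorem skorohodEDist_triangle {E : Type*} [PseudoEMetricSpace E] (N : TimeChange → ℝ≥0∞)
    (ht : ∀ l m : TimeChange, N (l.trans m) ≤ N l + N m) (x y z : Cadlag E) :
    skorohodEDist N x z ≤ skorohodEDist N x y + skorohodEDist N y z := by
  unfold skorohodEDist
  rw [ENNReal.iInf_add]
  refine le_iInf fun l => ?_
  rw [ENNReal.add_iInf]
  refine le_iInf fun m => iInf_le_of_le (l.trans m) (max_le ?_ (iSup_le fun t => ?_))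
  · exact (ht l m).trans (add_le_add (le_max_left _ _) (le_max_left _ _))
  · refine (edist_triangle _ (y (l t)) _).trans (add_le_add ?_ ?_)
    · exact (le_iSup (fun t : I => edist (x t) (y (l t))) t).trans (le_max_right _ _)
    · exact (le_iSup (fun t : I => edist (y t) (z (m t))) (l t)).trans (le_max_right _ _)

/-- The (pseudo-)metric structure given by `skorohodEDist N`. -/
@[reducible] noncomputable def skorohodPseudoEMetric {E : Type*} [PseudoEMetricSpace E]
    (N : TimeChange → ℝ≥0∞) (h0 : N (OrderIso.refl I) = 0)
    (hs : ∀ l : TimeChange, N l.symm ≤ N l)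
    (ht : ∀ l m : TimeChange, N (l.trans m) ≤ N l + N m) : PseudoEMetricSpace (Cadlag E) where
  edist := skorohodEDist N
  edist_self := skorohodEDist_self N h0
  edist_comm x y := le_antisymm (skorohodEDist_comm_le N hs x y) (skorohodEDist_comm_le N hs y x)
  edist_triangle := skorohodEDist_triangle N ht

/-- The Skorohod space `D = D([0,1]; ℝ)`. -/
abbrev SkorohodSpace : Type := Cadlag ℝ

/-- `D` carries the distance
`d⁰_{J₁}(x, y) = inf_{λ ∈ Λ} max ‖λ‖⁰ ‖x - y ∘ λ‖`, which induces the `J₁` topology. -/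
noncomputable instance SkorohodSpace.instPseudoEMetricSpace : PseudoEMetricSpace SkorohodSpace :=
  skorohodPseudoEMetric TimeChange.logNorm TimeChange.logNorm_refl TimeChange.logNorm_symm_le
    TimeChange.logNorm_trans_le

/-- The Borel σ-field of `D` for the `J₁` topology. -/
noncomputable instance SkorohodSpace.instMeasurableSpace : MeasurableSpace SkorohodSpace :=
  borel SkorohodSpace

instance SkorohodSpace.instBorelSpace : BorelSpace SkorohodSpace := ⟨rfl⟩

/-- The space `D([0,1]; D)` of functions `[0,1] → D`, càdlàg with respect to `J₁`. -/
abbrev SkorohodSpace₂ : Type := Cadlag SkorohodSpace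

/-- `D([0,1]; D)` carries the distance
`d_D(x, y) = inf_{λ ∈ Λ} max ‖λ - e‖ (sup_t d⁰_{J₁}(x(t), y(λ(t))))`. -/
noncomputable instance SkorohodSpace₂.instPseudoEMetricSpace :
    PseudoEMetricSpace SkorohodSpace₂ :=
  skorohodPseudoEMetric TimeChange.supNorm TimeChange.supNorm_refl TimeChange.supNorm_symm_le
    TimeChange.supNorm_trans_le

/-- The Borel σ-field of `D([0,1]; D)` for the distance `d_D`. -/
noncomputable instance SkorohodSpace₂.instMeasurableSpace : MeasurableSpace SkorohodSpace₂ :=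
  borel SkorohodSpace₂

instance SkorohodSpace₂.instBorelSpace : BorelSpace SkorohodSpace₂ := ⟨rfl⟩

/-- The projection `π_{t₁,…,t_k} : D([0,1]; D) → D^k`, `x ↦ (x(t₁), …, x(t_k))`. -/
def finProj {k : ℕ} (t : Fin k → I) (x : SkorohodSpace₂) : Fin k → SkorohodSpace :=
  fun i => x (t i)

/-- The class of finite-dimensional sets `π_{t₁,…,t_k}⁻¹(H)` with `k ≥ 1`, `t₁ < ⋯ < t_k` in `T`
and `H` in the `k`-fold product of the Borel σ-field of `D`. -/
def finiteDimSets (T : Set I) : Set (Set SkorohodSpace₂) :=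
  {A | ∃ k : ℕ, 1 ≤ k ∧ ∃ t : Fin k → I, StrictMono t ∧ (∀ i, t i ∈ T) ∧
    ∃ H : Set (Fin k → SkorohodSpace), MeasurableSet H ∧ A = finProj t ⁻¹' H}

/-! Everything rests on two approximations. Sampling `x` on the grid `k / n` gives step functions
converging to `x`, both in `D` and in `D([0,1]; D)`, and a step function depends continuously on its
values. For real values this makes `D` separable, so the Borel σ-field of `D^k` is the product one.
For values in `D` it writes the identity of `D([0,1]; D)` as a limit of maps that are measurable for
the evaluations. Evaluations at arbitrary times are limits of evaluations at times in `T`: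
right-continuity gives this below `1`, and `1 ∈ T` covers the endpoint. Hence the Borel σ-field is
contained in the generated one.

Conversely, evaluations are Borel: at `1` because time changes fix `1`, and elsewhere because
right-continuity reduces them to closed conditions on open sets of times. Finally,
finite-dimensional sets form a π-system, which gives (b). -/

namespace Cadlag

variable {E : Type*}

/-- A càdlàg function oscillates by at most `ε` on the cells of a suitable finite partition; two
points lie in the same cell if they lie to the right of the same partition points. -/
theorem exists_finset_forall_edist_le [PseudoEMetricSpace E] (x : Cadlag E) {ε : ℝ≥0∞}
    (hε : 0 < ε) :
    ∃ S : Finset I, ∀ u v : I, (∀ s ∈ S, s ≤ u ↔ s ≤ v) → edist (x u) (x v) ≤ ε := by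
  have hε2 : 0 < ε / 2 := ENNReal.half_pos hε.ne'
  have close {l a b : E} (ha : edist a l < ε / 2) (hb : edist b l < ε / 2) : edist a b ≤ ε :=
    (edist_triangle_right a b l).trans ((add_le_add ha.le hb.le).trans_eq (ENNReal.add_halves ε))
  suffices h : ∃ S : Finset I, ∀ u ∈ (univ : Set I), ∀ v : I, (∀ s ∈ S, s ≤ u ↔ s ≤ v) →
      edist (x u) (x v) ≤ ε by
    obtain ⟨S, hS⟩ := h
    exact ⟨S, fun u v => hS u (mem_univ u) v⟩
  refine (isCompact_univ (X := I)).induction_on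
    (p := fun W => ∃ S : Finset I, ∀ u ∈ W, ∀ v : I, (∀ s ∈ S, s ≤ u ↔ s ≤ v) →
      edist (x u) (x v) ≤ ε) ⟨∅, by simp⟩ ?_ ?_ ?_
  · rintro s t hst ⟨S, hS⟩
    exact ⟨S, fun u hu => hS u (hst hu)⟩
  · classical
    rintro s t ⟨S, hS⟩ ⟨S', hS'⟩
    refine ⟨S ∪ S', fun u hu v h => ?_⟩
    rcases hu with hu | hu
    · exact hS u hu v fun r hr => h r (Finset.mem_union_left _ hr)
    · exact hS' u hu v fun r hr => h r (Finset.mem_union_right _ hr)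
  · intro t _
    have hl : ∃ a : I, (∀ᶠ u in 𝓝[<] t, a ≤ u) ∧
        ∀ u v : I, a ≤ u → u < t → a ≤ v → v < t → edist (x u) (x v) ≤ ε := by
      rcases eq_or_lt_of_le (unitInterval.nonneg' (t := t)) with rfl | ht
      · exact ⟨0, by simp, fun u v _ hu => absurd hu (not_lt.2 unitInterval.nonneg')⟩
      · obtain ⟨l, hl⟩ := x.left_limits t ht
        have h := hl.eventually (Metric.eball_mem_nhds l hε2)
        obtain ⟨b, hbt, hb⟩ := (mem_nhdsLT_iff_exists_Ioo_subset' ht).1 h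
        obtain ⟨a, hba, hat⟩ := exists_between (mem_Iio.1 hbt)
        have ha {u : I} (h1 : a ≤ u) (h2 : u < t) := hb ⟨hba.trans_le h1, h2⟩
        refine ⟨a, ?_, fun u v h1 h2 h3 h4 => close (ha h1 h2) (ha h3 h4)⟩
        filter_upwards [Ico_mem_nhdsLT hat] with u hu using hu.1
    have hr : ∃ S : Finset I, (∀ᶠ u in 𝓝[≥] t, ∀ v, t ≤ v → (∀ s ∈ S, s ≤ u ↔ s ≤ v) →
        edist (x u) (x v) ≤ ε) := by
      rcases eq_or_lt_of_le (unitInterval.le_one' (t := t)) with rfl | ht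
      · refine ⟨∅, eventually_nhdsWithin_of_forall fun u hu v hv _ => ?_⟩
        rw [le_antisymm unitInterval.le_one' hu, le_antisymm unitInterval.le_one' hv, edist_self]
        exact zero_le
      · have h := (x.right_continuous t ht).eventually (Metric.eball_mem_nhds _ hε2)
        obtain ⟨b, htb, hb⟩ := (mem_nhdsGE_iff_exists_Ico_subset' ht).1 h
        -- Control holds only on `[t, b)`; making `b` a partition point keeps `v` below it.
        refine ⟨{b}, ?_⟩
        filter_upwards [Ico_mem_nhdsGE htb] with u hu v hv h
        refine close (hb hu) (hb ⟨hv, ?_⟩)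
        rw [← not_le, ← h b (by simp), not_le]
        exact hu.2
    classical
    obtain ⟨a, ha, hl⟩ := hl
    obtain ⟨S, hS⟩ := hr
    -- The points `a` and `t` isolate the cell `[a, t)`, where the left limit controls `x`, from the
    -- times right of `t`.
    let S' := insert a (insert t S)
    refine ⟨{u | ∀ v : I, (∀ s ∈ S', s ≤ u ↔ s ≤ v) → edist (x u) (x v) ≤ ε}, ?_, S',
      fun u hu => hu⟩
    rw [nhdsWithin_univ, ← nhdsLT_sup_nhdsGE]
    constructor
    · filter_upwards [ha, self_mem_nhdsWithin] with u hu hut v h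
      refine hl u v hu hut ((h a (by simp [S'])).1 hu) ?_
      rw [← not_le, ← h t (by simp [S']), not_le]
      exact hut
    · filter_upwards [hS, self_mem_nhdsWithin] with u hu hut v h
      exact hu v ((h t (by simp [S'])).1 hut) fun s hs => h s (by simp [S', hs])

end Cadlag

/-! ### Time changes that are Lipschitz-close to the identity -/

namespace TimeChange

/-- A perturbation of the identity on a finite set, Lipschitz with constant `δ < 1` and fixing the
endpoints, extends to a time change. -/
theorem exists_extend {S : Set I} (h0 : 0 ∈ S) (h1 : 1 ∈ S) {δ : NNReal} (hδ : δ < 1)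
    (r : I → I) (r0 : r 0 = 0) (r1 : r 1 = 1)
    (hr : LipschitzOnWith δ (fun s => (r s : ℝ) - s) S) :
    ∃ l : TimeChange, (∀ s ∈ S, l s = r s) ∧ LipschitzWith δ (fun s => (l s : ℝ) - s) := by
  -- Extend the displacement, not the map: the identity plus a `δ`-Lipschitz function is strictly
  -- increasing because `δ < 1`.
  obtain ⟨g, hg, hgS⟩ := hr.extend_real
  have hmono : StrictMono fun t : I => (t : ℝ) + g t := by
    intro s t hst
    have hst' : (s : ℝ) < t := hst
    have h := hg.dist_le_mul s t
    rw [Real.dist_eq, Subtype.dist_eq, Real.dist_eq, abs_of_neg (sub_neg.2 hst')] at h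
    have h2 := (abs_le.1 h).2
    have h3 : (δ : ℝ) < 1 := hδ
    simp only
    nlinarith
  have g0 : g 0 = 0 := by rw [← hgS h0]; simp [r0]
  have g1 : g 1 = 0 := by rw [← hgS h1]; simp [r1]
  let f : I → I := fun t => ⟨(t : ℝ) + g t, by
    have := hmono.monotone (unitInterval.nonneg' (t := t))
    simpa [g0] using this, by
    have := hmono.monotone (unitInterval.le_one' (t := t))
    simpa [g1] using this⟩
  have hf : Continuous f := (continuous_subtype_val.add hg.continuous).subtype_mk _
  obtain ⟨l, hl⟩ := (exists_timeChange_iff f).2 ⟨fun s t h => hmono h, hf, fun c =>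
    mem_range_of_exists_le_of_exists_ge hf
      ⟨0, by simp [f, g0]⟩
      ⟨1, by simpa [f, g1, ← Subtype.coe_le_coe] using unitInterval.le_one c⟩⟩
  refine ⟨l, fun s hs => ?_, ?_⟩
  · ext
    have := hgS hs
    simp only at this
    simp [hl, f, ← this]
  · simpa [hl, f] using hg

/-- Since `l` fixes `0`, the displacement at `t` is at most `δ * t`. -/
theorem supNorm_le_of_lipschitzWith {l : TimeChange} {δ : NNReal}
    (h : LipschitzWith δ (fun s => (l s : ℝ) - s)) : supNorm l ≤ δ := by
  refine iSup_le fun t => ?_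
  have h0 : l 0 = 0 := l.map_bot
  have h2 := h.edist_le_mul t 0
  rw [edist_dist, Subtype.dist_eq, Real.dist_eq]
  simp only [h0, edist_dist (α := ℝ), Real.dist_eq, Icc.coe_zero, sub_zero] at h2
  refine h2.trans ((mul_le_mul_right ?_ _).trans (mul_one _).le)
  rw [edist_dist, Subtype.dist_eq, Real.dist_eq, Icc.coe_zero, sub_zero, abs_of_nonneg t.2.1]
  simpa using t.2.2

/-- All difference quotients of `l` lie in `[1 - δ, 1 + δ]`. The bound `δ ≤ 1 / 2` is what gives `1
/ (1 - δ) ≤ 1 + 2 * δ`. -/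
theorem logNorm_le_of_lipschitzWith {l : TimeChange} {δ : NNReal} (hδ : δ ≤ 1 / 2)
    (h : LipschitzWith δ (fun s => (l s : ℝ) - s)) : logNorm l ≤ 2 * δ := by
  refine iSup_le fun s => iSup_le fun t => iSup_le fun hst => ?_
  have hδ' : (δ : ℝ) ≤ 1 / 2 := by exact_mod_cast hδ
  have hst' : (0 : ℝ) < t - s := sub_pos.2 (Subtype.coe_lt_coe.2 hst)
  have h2 := h.dist_le_mul t s
  rw [Real.dist_eq, Subtype.dist_eq, Real.dist_eq, abs_of_pos hst', abs_le] at h2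
  set q : ℝ := ((l t : ℝ) - l s) / (t - s) with hq
  have hq1 : 1 - δ ≤ q := by rw [hq, le_div_iff₀ hst']; linarith
  have hq2 : q ≤ 1 + δ := by rw [hq, div_le_iff₀ hst']; linarith
  have hq0 : 0 < q := by linarith
  have hδ0 : (0 : ℝ) ≤ δ := δ.2
  have e : (2 * δ : ℝ≥0∞) = ENNReal.ofReal (2 * δ) := by
    rw [ENNReal.ofReal_mul (by norm_num)]; simp
  rw [e]
  refine ENNReal.ofReal_le_ofReal (abs_le.2 ⟨?_, ?_⟩)
  · have h3 := Real.one_sub_inv_le_log_of_pos hq0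
    have h4 : q⁻¹ ≤ 1 + 2 * δ := by
      rw [inv_le_iff_one_le_mul₀ hq0]
      nlinarith
    linarith
  · have := Real.log_le_sub_one_of_pos hq0
    linarith

end TimeChange

theorem skorohodEDist_le_of_forall_edist_le {E : Type*} [PseudoEMetricSpace E]
    {N : TimeChange → ℝ≥0∞} (h0 : N (OrderIso.refl I) = 0) {x y : Cadlag E} {c : ℝ≥0∞}
    (h : ∀ t, edist (x t) (y t) ≤ c) : skorohodEDist N x y ≤ c :=
  iInf_le_of_le (OrderIso.refl I) (by simpa [h0] using h)

/-! ### Approximation by step functions on a grid -/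

namespace Cadlag

variable {E : Type*}

/-- The function with value `v i` on `[i / n, (i + 1) / n)`. -/
noncomputable def step [TopologicalSpace E] (n : ℕ) (v : Fin (n + 1) → E) : Cadlag E where
  -- The floor is at most `n` on `[0,1]`, so the reduction modulo `n + 1` never acts.
  toFun t := v (Fin.ofNat (n + 1) ⌊n * (t : ℝ)⌋₊)
  right_continuous t _ := by
    refine (tendsto_const_nhds (x := v (Fin.ofNat (n + 1) ⌊n * (t : ℝ)⌋₊))).congr' ?_
    have h : ∀ᶠ s : I in 𝓝[≥] t, n * (s : ℝ) < ⌊n * (t : ℝ)⌋₊ + 1 :=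
      mem_nhdsWithin_of_mem_nhds ((by fun_prop : Continuous fun s : I => n * (s : ℝ)).continuousAt
        |>.eventually_lt_const (Nat.lt_floor_add_one _))
    filter_upwards [h, self_mem_nhdsWithin] with s hs hts
    congr 2
    have hts' : (t : ℝ) ≤ s := hts
    refine le_antisymm (Nat.floor_mono (by gcongr)) (Nat.lt_succ_iff.1 ?_)
    rw [Nat.floor_lt (by have := s.2.1; positivity)]
    exact_mod_cast hs
  left_limits t ht := by
    -- Just left of `t` the floor equals `⌈n * t⌉₊ - 1`, whether or not `n * t` is an integer.
    refine ⟨v (Fin.ofNat (n + 1) (⌈n * (t : ℝ)⌉₊ - 1)),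
      (tendsto_const_nhds (x := v (Fin.ofNat (n + 1) (⌈n * (t : ℝ)⌉₊ - 1)))).congr' ?_⟩
    rcases Nat.eq_zero_or_pos n with rfl | hn
    · simp
    have ht' : (0 : ℝ) < t := ht
    have hpos : (0 : ℝ) < n * (t : ℝ) := by positivity
    have hc := Nat.ceil_pos.2 hpos
    have h : ∀ᶠ s : I in 𝓝[<] t, ((⌈n * (t : ℝ)⌉₊ - 1 : ℕ) : ℝ) < n * (s : ℝ) :=
      mem_nhdsWithin_of_mem_nhds ((by fun_prop : Continuous fun s : I => n * (s : ℝ)).continuousAt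
        |>.eventually_const_lt (Nat.lt_ceil.1 (by lia)))
    filter_upwards [h, self_mem_nhdsWithin] with s hs hst
    have hst' : (s : ℝ) < t := hst
    have h1 : ⌊n * (s : ℝ)⌋₊ < ⌈n * (t : ℝ)⌉₊ := by
      rw [Nat.lt_ceil]
      exact (Nat.floor_le (by have := s.2.1; positivity)).trans_lt (by gcongr)
    have h2 := Nat.le_floor hs.le
    congr 2
    lia

/-- The point `k / n` of the unit interval, truncated. -/
noncomputable def gridPoint (n k : ℕ) : I := projIcc 0 1 zero_le_one ((k : ℝ) / n)

theorem coe_gridPoint {n k : ℕ} (h : k ≤ n) : (gridPoint n k : ℝ) = k / n := by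
  rw [gridPoint, projIcc_of_mem]
  exact ⟨by positivity, div_le_one_of_le₀ (by exact_mod_cast h) (by positivity)⟩

theorem floor_mul_le (n : ℕ) (t : I) : ⌊n * (t : ℝ)⌋₊ ≤ n :=
  Nat.floor_le_of_le (mul_le_of_le_one_right (by positivity) t.2.2)

theorem ceil_mul_le (n : ℕ) (t : I) : ⌈n * (t : ℝ)⌉₊ ≤ n :=
  Nat.ceil_le.2 (mul_le_of_le_one_right (by positivity) t.2.2)

theorem step_sample_apply [TopologicalSpace E] (x : Cadlag E) (n : ℕ) (t : I) :
    step n (fun i => x (gridPoint n i)) t = x (gridPoint n ⌊n * (t : ℝ)⌋₊) := by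
  have := floor_mul_le n t
  simp [step, Nat.mod_eq_of_lt (Nat.lt_succ_of_le this)]

theorem edist_step_apply_le [PseudoEMetricSpace E] (n : ℕ) (v w : Fin (n + 1) → E) (t : I) :
    edist (step n v t) (step n w t) ≤ edist v w :=
  edist_le_pi_edist v w _

/-- Sampling a càdlàg function on a fine grid changes it little, up to a time change close to the
identity in the Lipschitz sense. -/
theorem eventually_exists_timeChange [PseudoEMetricSpace E] (x : Cadlag E) {ε : ℝ≥0∞}
    (hε : 0 < ε) {δ : NNReal} (hδ0 : 0 < δ) (hδ : δ < 1) :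
    ∀ᶠ n : ℕ in atTop, ∃ l : TimeChange, LipschitzWith δ (fun s => (l s : ℝ) - s) ∧
      ∀ t, edist (x t) (step n (fun i => x (gridPoint n i)) (l t)) ≤ ε := by
  classical
  obtain ⟨S₀, hS₀⟩ := x.exists_finset_forall_edist_le hε
  let S := insert 0 (insert 1 S₀)
  have hS : ∀ u v : I, (∀ s ∈ S, s ≤ u ↔ s ≤ v) → edist (x u) (x v) ≤ ε :=
    fun u v h => hS₀ u v fun s hs => h s (by simp [S, hs])
  -- Partition points are rounded up to the grid. As `S` is finite, the displacements are eventually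
  -- `δ`-Lipschitz on it.
  let r : ℕ → I → I := fun n s => gridPoint n ⌈n * (s : ℝ)⌉₊
  have hr (n : ℕ) (s : I) : (r n s : ℝ) = ⌈n * (s : ℝ)⌉₊ / n := coe_gridPoint (ceil_mul_le n s)
  have hlim (s : I) : Tendsto (fun n => (r n s : ℝ) - s) atTop (𝓝 0) := by
    refine squeeze_zero_norm' ?_ tendsto_one_div_atTop_nhds_zero_nat
    filter_upwards [eventually_gt_atTop 0] with n hn
    have hn' : (0 : ℝ) < n := by exact_mod_cast hn
    have h1 := Nat.le_ceil (n * (s : ℝ))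
    have h2 := Nat.ceil_lt_add_one (mul_nonneg hn'.le s.2.1)
    have e : (r n s : ℝ) - s = (⌈n * (s : ℝ)⌉₊ - n * s) / n := by rw [hr]; field_simp
    rw [e, Real.norm_eq_abs, abs_of_nonneg (div_nonneg (by linarith) hn'.le)]
    gcongr
    linarith
  have hlip : ∀ᶠ n in atTop, ∀ s ∈ S, ∀ s' ∈ S,
      dist ((r n s : ℝ) - s) ((r n s' : ℝ) - s') ≤ δ * dist s s' := by
    refine (Finset.eventually_all S).2 fun s _ => (Finset.eventually_all S).2 fun s' _ => ?_
    rcases eq_or_ne s s' with rfl | hne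
    · simp
    · have h := (hlim s).dist (hlim s')
      rw [dist_self] at h
      exact h.eventually_le_const (mul_pos hδ0 (dist_pos.2 hne))
  filter_upwards [hlip, eventually_gt_atTop 0] with n hn hn0
  have hn' : (0 : ℝ) < n := by exact_mod_cast hn0
  obtain ⟨l, hlS, hl⟩ := TimeChange.exists_extend (S := S) (by simp [S]) (by simp [S]) hδ (r n)
    (by ext; simp [hr]) (by ext; simp [hr, hn'.ne'])
    (LipschitzOnWith.of_dist_le_mul fun s hs s' hs' => hn s hs s' hs')
  refine ⟨l, hl, fun t => ?_⟩
  rw [step_sample_apply]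
  -- Rounding `l t` down to the grid preserves its comparison with the grid point `l s`, so the
  -- sampled time lies in the cell of `t`.
  refine hS _ _ fun s hs => ?_
  have hw : 0 ≤ n * (l t : ℝ) := mul_nonneg hn'.le (l t).2.1
  rw [← l.le_iff_le, hlS s hs, ← Subtype.coe_le_coe, ← Subtype.coe_le_coe, hr,
    coe_gridPoint (floor_mul_le n _), div_le_iff₀' hn', ← Nat.le_floor_iff hw, Nat.ceil_le,
    le_div_iff₀' hn']

/-- Samples on finer and finer grids converge in a Skorohod distance whose cost is controlled by
Lipschitz closeness to the identity. -/
theorem eventually_skorohodEDist_step_le [PseudoEMetricSpace E] {N : TimeChange → ℝ≥0∞}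
    (hN : ∀ (l : TimeChange) (δ : NNReal), δ ≤ 1 / 2 →
      LipschitzWith δ (fun s => (l s : ℝ) - s) → N l ≤ 2 * δ) (x : Cadlag E) {ε : ℝ≥0∞}
    (hε : 0 < ε) :
    ∀ᶠ n in atTop, skorohodEDist N x (step n fun i => x (gridPoint n i)) ≤ ε := by
  obtain ⟨δ, hδ0, hδε⟩ := ENNReal.lt_iff_exists_nnreal_btwn.1 (ENNReal.half_pos hε.ne')
  have hδ0' : 0 < δ := by exact_mod_cast hδ0
  have hle : min δ (1 / 2) ≤ 1 / 2 := min_le_right _ _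
  have h2 : 2 * ((min δ (1 / 2) : NNReal) : ℝ≥0∞) ≤ ε := by
    calc 2 * ((min δ (1 / 2) : NNReal) : ℝ≥0∞) ≤ 2 * (ε / 2) := by
          gcongr
          exact (ENNReal.coe_le_coe.2 (min_le_left _ _)).trans hδε.le
      _ = ε := ENNReal.mul_div_cancel (by simp) (by simp)
  filter_upwards [x.eventually_exists_timeChange hε (δ := min δ (1 / 2))
    (lt_min hδ0' (by norm_num)) (hle.trans_lt (by norm_num))] with n hn
  obtain ⟨l, hl, h⟩ := hn
  exact iInf_le_of_le l (max_le ((hN l _ hle hl).trans h2) (iSup_le h))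

end Cadlag

open TopologicalSpace

/-! ### Separability of `D` -/

namespace SkorohodSpace

theorem continuous_step (n : ℕ) :
    Continuous fun v : Fin (n + 1) → ℝ => (Cadlag.step n v : SkorohodSpace) := by
  refine LipschitzWith.continuous (K := 1) fun v w => ?_
  rw [ENNReal.coe_one, one_mul]
  exact skorohodEDist_le_of_forall_edist_le TimeChange.logNorm_refl
    (Cadlag.edist_step_apply_le n v w)

theorem tendsto_step (x : SkorohodSpace) :
    Tendsto (fun n => (Cadlag.step n fun i => x (Cadlag.gridPoint n i) : SkorohodSpace)) atTop
      (𝓝 x) := by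
  refine EMetric.tendsto_nhds.2 fun ε hε => ?_
  obtain ⟨c, hc, hcε⟩ := exists_between hε
  filter_upwards [Cadlag.eventually_skorohodEDist_step_le
    (fun l _ => TimeChange.logNorm_le_of_lipschitzWith) x hc] with n hn
  rw [edist_comm]
  exact hn.trans_lt hcε

instance instSeparableSpace : SeparableSpace SkorohodSpace := by
  rw [← isSeparable_univ_iff]
  refine (IsSeparable.closure (IsSeparable.iUnion fun n => isSeparable_range
    (continuous_step n))).mono fun x _ => mem_closure_of_tendsto (tendsto_step x) ?_
  exact Eventually.of_forall fun n => mem_iUnion.2 ⟨n, mem_range_self _⟩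

instance instSecondCountableTopology : SecondCountableTopology SkorohodSpace :=
  UniformSpace.secondCountable_of_separable SkorohodSpace

end SkorohodSpace

/-! ### Borel measurability of evaluations -/

namespace SkorohodSpace₂

theorem continuous_step (n : ℕ) :
    Continuous fun v : Fin (n + 1) → SkorohodSpace => (Cadlag.step n v : SkorohodSpace₂) := by
  refine LipschitzWith.continuous (K := 1) fun v w => ?_
  rw [ENNReal.coe_one, one_mul]
  exact skorohodEDist_le_of_forall_edist_le TimeChange.supNorm_refl
    (Cadlag.edist_step_apply_le n v w)

theorem tendsto_step (x : SkorohodSpace₂) :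
    Tendsto (fun n => (Cadlag.step n fun i => x (Cadlag.gridPoint n i) : SkorohodSpace₂)) atTop
      (𝓝 x) := by
  refine EMetric.tendsto_nhds.2 fun ε hε => ?_
  obtain ⟨c, hc, hcε⟩ := exists_between hε
  filter_upwards [Cadlag.eventually_skorohodEDist_step_le
    (fun l δ _ h => (TimeChange.supNorm_le_of_lipschitzWith h).trans
      (le_mul_of_one_le_left zero_le one_le_two)) x hc] with n hn
  rw [edist_comm]
  exact hn.trans_lt hcε

theorem exists_timeChange_of_edist_lt {x y : SkorohodSpace₂} {ε : ℝ≥0∞} (h : edist x y < ε) :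
    ∃ l : TimeChange, (∀ t, edist (l t) t < ε) ∧ ∀ t, edist (x t) (y (l t)) < ε := by
  obtain ⟨l, hl⟩ := iInf_lt_iff.1 (show skorohodEDist TimeChange.supNorm x y < ε from h)
  obtain ⟨h1, h2⟩ := max_lt_iff.1 hl
  exact ⟨l, fun t => (le_iSup (fun t => edist (l t) t) t).trans_lt h1,
    fun t => (le_iSup (fun t => edist (x t) (y (l t))) t).trans_lt h2⟩

/-- If `y` is close to `x`, then `x s` is close to `y (l s)`, and `l s` is close enough to `s` to
remain in the open set `U`. -/
theorem isClosed_setOf_forall_mem {U : Set I} (hU : IsOpen U) {F : Set SkorohodSpace}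
    (hF : IsClosed F) : IsClosed {x : SkorohodSpace₂ | ∀ s ∈ U, x s ∈ F} := by
  refine isClosed_of_closure_subset fun x hx s hs => ?_
  obtain ⟨δ, hδ, hδU⟩ := EMetric.isOpen_iff.1 hU s hs
  refine hF.closure_subset (EMetric.mem_closure_iff.2 fun ε hε => ?_)
  obtain ⟨y, hy, hxy⟩ := EMetric.mem_closure_iff.1 hx (min δ ε) (lt_min hδ hε)
  obtain ⟨l, hl, h⟩ := exists_timeChange_of_edist_lt hxy
  exact ⟨y (l s), hy _ (hδU ((hl s).trans_le (min_le_left _ _))),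
    (h s).trans_le (min_le_right _ _)⟩

theorem continuous_apply_one : Continuous fun x : SkorohodSpace₂ => x 1 := by
  refine LipschitzWith.continuous (K := 1) fun x y => ?_
  rw [ENNReal.coe_one, one_mul]
  refine le_of_forall_gt fun c hc => ?_
  obtain ⟨l, -, h⟩ := exists_timeChange_of_edist_lt hc
  have h1 := h 1
  rwa [show l 1 = 1 from l.map_top] at h1

theorem measurable_apply (t : I) : Measurable fun x : SkorohodSpace₂ => x t := by
  rcases eq_or_lt_of_le (unitInterval.le_one' (t := t)) with rfl | ht
  · exact continuous_apply_one.measurable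
  refine measurable_of_isOpen fun U hU => ?_
  -- By right-continuity, `x t ∈ U` iff `x` stays a fixed distance away from `Uᶜ` just after `t`.
  -- Excluding `t` itself makes the set of times open.
  have e : (fun x : SkorohodSpace₂ => x t) ⁻¹' U = ⋃ (n : ℕ) (m : ℕ), {x : SkorohodSpace₂ |
      ∀ s ∈ Ioi t ∩ Metric.eball t (m : ℝ≥0∞)⁻¹,
        x s ∈ (fun y => Metric.infEDist y Uᶜ) ⁻¹' Ici (n : ℝ≥0∞)⁻¹} := by
    ext x
    simp only [mem_preimage, mem_iUnion, mem_ofPred_eq]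
    constructor
    · intro hx
      have h0 : Metric.infEDist (x t) Uᶜ ≠ 0 := fun h0 =>
        (Metric.mem_iff_infEDist_zero_of_closed hU.isClosed_compl).2 h0 hx
      obtain ⟨n, hn⟩ := ENNReal.exists_inv_nat_lt h0
      have hev := (Metric.continuous_infEDist (s := Uᶜ)).continuousAt.tendsto.comp
        (x.right_continuous t ht) |>.eventually_const_lt hn
      obtain ⟨δ, hδ, h⟩ := EMetric.mem_nhdsWithin_iff.1 hev
      obtain ⟨m, hm⟩ := ENNReal.exists_inv_nat_lt hδ.ne'
      exact ⟨n, m, fun s hs =>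
        (mem_Ioi.1 (h ⟨Metric.eball_subset_eball hm.le hs.2, (mem_Ioi.1 hs.1).le⟩)).le⟩
    · rintro ⟨n, m, h⟩
      have hF : IsClosed ((fun y => Metric.infEDist y Uᶜ) ⁻¹' Ici (n : ℝ≥0∞)⁻¹) :=
        isClosed_Ici.preimage Metric.continuous_infEDist
      have := nhdsGT_neBot_of_exists_gt ⟨1, ht⟩
      have hmem : x t ∈ (fun y => Metric.infEDist y Uᶜ) ⁻¹' Ici (n : ℝ≥0∞)⁻¹ := by
        refine hF.mem_of_tendsto ((x.right_continuous t ht).mono_left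
          (nhdsWithin_mono t Ioi_subset_Ici_self)) ?_
        filter_upwards [self_mem_nhdsWithin, mem_nhdsWithin_of_mem_nhds
          (Metric.eball_mem_nhds t (ENNReal.inv_pos.2 (ENNReal.natCast_ne_top m)))] with s h1 h2
        exact h s ⟨h1, h2⟩
      by_contra hx
      rw [mem_preimage, Metric.infEDist_zero_of_mem (mem_compl hx)] at hmem
      exact (ENNReal.inv_pos.2 (ENNReal.natCast_ne_top n)).not_ge hmem
  rw [e]
  exact MeasurableSet.iUnion fun n => MeasurableSet.iUnion fun m =>
    (isClosed_setOf_forall_mem (isOpen_Ioi.inter Metric.isOpen_eball)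
      (isClosed_Ici.preimage Metric.continuous_infEDist)).measurableSet

/-! ### The generated σ-field and the π-system -/

theorem exists_seq_tendsto_apply {T : Set I} (hT : Dense T) (h1 : (1 : I) ∈ T) (t : I) :
    ∃ u : ℕ → I, (∀ n, u n ∈ T) ∧
      ∀ x : SkorohodSpace₂, Tendsto (fun n => x (u n)) atTop (𝓝 (x t)) := by
  rcases eq_or_lt_of_le (unitInterval.le_one' (t := t)) with rfl | ht
  · exact ⟨fun _ => 1, fun _ => h1, fun x => tendsto_const_nhds⟩
  have h : t ∈ closure (Ioi t ∩ T) :=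
    closure_minimal (hT.open_subset_closure_inter (isOpen_Ioi (a := t))) isClosed_closure (by
      rw [closure_Ioi' (a := t) ⟨1, ht⟩]; exact self_mem_Ici)
  obtain ⟨u, hu, hut⟩ := mem_closure_iff_seq_limit.1 h
  refine ⟨u, fun n => (hu n).2, fun x => (x.right_continuous t ht).tendsto.comp ?_⟩
  exact tendsto_nhdsWithin_iff.2 ⟨hut, Eventually.of_forall fun n => (mem_Ioi.1 (hu n).1).le⟩

theorem measurable_apply_generateFrom {T : Set I} (hT : Dense T) (h1 : (1 : I) ∈ T) (t : I) :
    Measurable[MeasurableSpace.generateFrom (finiteDimSets T)]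
      fun x : SkorohodSpace₂ => x t := by
  obtain ⟨u, hu, hlim⟩ := exists_seq_tendsto_apply hT h1 t
  refine @measurable_of_tendsto_metrizable _ _ (MeasurableSpace.generateFrom (finiteDimSets T))
    _ _ _ _ (fun n x => x (u n)) _ (fun n B hB => ?_) (tendsto_pi_nhds.2 hlim)
  exact MeasurableSpace.measurableSet_generateFrom ⟨1, le_rfl, fun _ => u n,
    Subsingleton.strictMono _, fun _ => hu n, _, measurable_pi_apply 0 hB, rfl⟩

theorem borel_eq_generateFrom {T : Set I} (hT : Dense T) (h1 : (1 : I) ∈ T) :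
    borel SkorohodSpace₂ = MeasurableSpace.generateFrom (finiteDimSets T) := by
  apply le_antisymm
  · have h : Measurable[MeasurableSpace.generateFrom (finiteDimSets T)]
        (id : SkorohodSpace₂ → SkorohodSpace₂) := by
      refine @measurable_of_tendsto_metrizable _ _
        (MeasurableSpace.generateFrom (finiteDimSets T)) _ _ _ _
        (fun n x => Cadlag.step n fun i => x (Cadlag.gridPoint n i)) _ (fun n => ?_)
        (tendsto_pi_nhds.2 tendsto_step)
      exact @Measurable.comp _ _ _ (MeasurableSpace.generateFrom (finiteDimSets T)) _ _ _ _
        (continuous_step n).measurable ((@measurable_pi_iff _ _ _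
          (MeasurableSpace.generateFrom (finiteDimSets T)) _ _).2 fun i =>
            measurable_apply_generateFrom hT h1 (Cadlag.gridPoint n i))
    exact fun A hA => h hA
  · refine MeasurableSpace.generateFrom_le ?_
    rintro _ ⟨k, -, t, -, -, H, hH, rfl⟩
    exact (measurable_pi_iff.2 fun i => measurable_apply (t i) : Measurable (finProj t)) hH

/-- Enlarging the set of times only adds unconstrained coordinates; this brings two
finite-dimensional sets to common, sorted times. -/
theorem exists_preimage_finProj_eq {S : Finset I} {k : ℕ} {t : Fin k → I} (ht : ∀ i, t i ∈ S)
    {H : Set (Fin k → SkorohodSpace)} (hH : MeasurableSet H) :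
    ∃ H' : Set (Fin S.card → SkorohodSpace), MeasurableSet H' ∧
      finProj t ⁻¹' H = finProj (S.orderEmbOfFin rfl) ⁻¹' H' := by
  have h (i : Fin k) : ∃ j, S.orderEmbOfFin rfl j = t i := by
    have := ht i
    rwa [← Finset.mem_coe, ← S.range_orderEmbOfFin rfl] at this
  choose j hj using h
  refine ⟨(fun v i => v (j i)) ⁻¹' H,
    (measurable_pi_iff.2 fun i => measurable_pi_apply (j i)) hH, ?_⟩
  ext x
  simp only [mem_preimage]
  rw [show (fun i => finProj (S.orderEmbOfFin rfl) x (j i)) = finProj t x by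
    ext1 i; simp [finProj, hj]]

theorem isPiSystem_finiteDimSets (T : Set I) : IsPiSystem (finiteDimSets T) := by
  classical
  rintro _ ⟨k, hk, t, -, htT, H, hH, rfl⟩ _ ⟨m, -, u, -, huT, K, hK, rfl⟩ -
  let S := Finset.univ.image t ∪ Finset.univ.image u
  obtain ⟨H', hH', e⟩ := exists_preimage_finProj_eq (S := S) (t := t) (by simp [S]) hH
  obtain ⟨K', hK', e'⟩ := exists_preimage_finProj_eq (S := S) (t := u) (by simp [S]) hK
  refine ⟨S.card, Finset.card_pos.2 ⟨t ⟨0, hk⟩, by simp [S]⟩, S.orderEmbOfFin rfl,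
    (S.orderEmbOfFin rfl).strictMono, fun i => ?_, H' ∩ K', hH'.inter hK', by
      rw [e, e', preimage_inter]⟩
  have := S.orderEmbOfFin_mem rfl i
  simp only [S, Finset.mem_union, Finset.mem_image, Finset.mem_univ, true_and] at this
  rcases this with ⟨a, ha⟩ | ⟨a, ha⟩
  · rw [← ha]; exact htT a
  · rw [← ha]; exact huT a

end SkorohodSpace₂

theorem mainTheorem5 (T : Set I) (hT : Dense T) (h1 : (1 : I) ∈ T) :
    borel SkorohodSpace₂ = MeasurableSpace.generateFrom (finiteDimSets T) ∧
    ∀ P Q : Measure SkorohodSpace₂, IsProbabilityMeasure P → IsProbabilityMeasure Q →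
      (∀ A ∈ finiteDimSets T, P A = Q A) → P = Q := by
  have h := SkorohodSpace₂.borel_eq_generateFrom hT h1
  refine ⟨h, fun P Q _ _ hPQ => ?_⟩
  exact ext_of_generate_finite _ h (SkorohodSpace₂.isPiSystem_finiteDimSets T) hPQ (by simp)
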